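/- Let $(\Omega,\mathcal F,P)$ be a nonatomic probability space and $L^\infty_+=\{X\in L^\infty(\Omega,\mathcal F,P) : X\ge 0\ P\text{-a.s.}\}$. Let $\rho\colon L^\infty_+\to[0,+\infty)$ be a convex return risk measure, i.e. $\rho$ is convex, monotone ($X\le Y$ a.s. implies $\rho(X)\le\rho(Y)$), positively homogeneous ($\rho(\lambda X)=\lambda\rho(X)$ for $\lambda\ge 0$) and $\rho(1)=1$. Assume that $\rho$ has the Fatou property: if $X_n\to X$ in probability and $\|X_n\|_\infty\le k$ for all $n$ and some constant $k$, then $\rho(X)\le\liminf_n\rho(X_n)$. Put $B_\rho=\{X\in L^\infty_+:\rho(X)\le 1\}$, let $\mathbf P$ be the set of probability measures on $(\Omega,\mathcal F)$ that are absolutely continuous with respect to $P$, and for $Q\in\mathbf P$ let $\varphi_Q=\mathrm dQ/\mathrm dP$ and $$\beta(Q)=\Big[\sup_{X\in B_\rho}\mathbb E_Q[X]\Big]^{-1}\qquad (1/\infty:=0).$$ 1. $\beta(Q)\in[0,1]$ for every $Q\in\mathbf P$, and $$\rho(X)=\sup_{Q\in\mathbf P}\{\beta(Q)\,\mathbb E_Q[X]\}\qquad\text{for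 all }X\in L^\infty_+ .$$ 2. If $\rho$ has the Lebesgue property, that is, $\rho(X_n)\to\rho(X)$ whenever $X_n\to X$ in probability and $\|X_n\|_\infty\le k$ for all $n$ and some constant $k$, then for every $X\in L^\infty_+$ the supremum in 1 is attained. 3. For a real random variable $Z$, call $q_Z$ a version of its quantile function if $P(Z<q_Z(t))\le t\le P(Z\le q_Z(t))$ for all $t\in(0,1)$. If $\rho$ is law-invariant ($\rho(X)=\rho(Y)$ whenever $X$ and $Y$ have the same distribution under $P$), then, for any versions of the quantile functions, for all $Q\in\mathbf P$ and all $X\in L^\infty_+$, $$\beta(Q)=\Big[\sup_{Y\in B_\rho}\int_0^1 q_Y(t)\,q_{\varphi_Q}(t)\,\mathrm dt\Big]^{-1},\qquad \rho(X)=\sup_{R\in\mathbf P}\Big\{\beta(R)\int_0^1 q_X(t)\,q_{\varphi_R}(t)\,\mathrm dt\Big\}.$$ -/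

import Mathlib

open MeasureTheory Filter Topology Set
open scoped ENNReal NNReal

namespace ReturnRisk

variable {Ω : Type*} [MeasurableSpace Ω]

/-- A measure is nonatomic if every measurable set of positive measure contains a measurable
subset of strictly smaller positive measure. (Mathlib's `NoAtoms` only says that singletons are
null, which is weaker.) -/
def IsNonatomic (P : Measure Ω) : Prop :=
  ∀ A : Set Ω, MeasurableSet A → 0 < P A →
    ∃ B : Set Ω, MeasurableSet B ∧ B ⊆ A ∧ 0 < P B ∧ P B < P A

/-- The cone `L^∞_+` of (classes of) essentially bounded random variables that are `P`-a.s.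
nonnegative. -/
noncomputable def LinfPos (P : Measure Ω) : Submodule ℝ≥0 (Lp ℝ ∞ P) where
  carrier := {X | 0 ≤ X}
  add_mem' := by
    intro X Y hX hY
    exact add_nonneg (show (0 : Lp ℝ ∞ P) ≤ X from hX) (show (0 : Lp ℝ ∞ P) ≤ Y from hY)
  zero_mem' := le_refl (0 : Lp ℝ ∞ P)
  smul_mem' := by
    intro c X hX
    have hX' : 0 ≤ᵐ[P] X := (Lp.coeFn_nonneg X).2 hX
    refine (Lp.coeFn_nonneg (c • X)).1 ?_
    have h : ⇑(c • X) =ᵐ[P] (c : ℝ) • ⇑X := Lp.coeFn_smul (c : ℝ) X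
    filter_upwards [hX', h] with ω h0 h1
    rw [h1]
    exact mul_nonneg c.2 h0

/-- The constant random variable `1`. -/
noncomputable def oneLinf (P : Measure Ω) [IsProbabilityMeasure P] : LinfPos P :=
  ⟨Lp.const ∞ P (1 : ℝ), by
    refine (Lp.coeFn_nonneg (Lp.const ∞ P (1 : ℝ))).1 ?_
    filter_upwards [Lp.coeFn_const ∞ P (1 : ℝ)] with ω h
    rw [h]
    exact zero_le_one (α := ℝ)⟩

/-- A random variable in `L^∞_+` as a function on `Ω` (determined up to `P`-null sets). -/
noncomputable def rv {P : Measure Ω} (X : LinfPos P) : Ω → ℝ := ⇑(X : Lp ℝ ∞ P)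

/-- Return risk measures `ρ : L^∞_+ → [0, ∞)`: monotone, positively homogeneous, `ρ 1 = 1`. -/
structure IsReturnRiskMeasure {P : Measure Ω} [IsProbabilityMeasure P]
    (ρ : LinfPos P → ℝ≥0) : Prop where
  mono : ∀ X Y : LinfPos P, X ≤ Y → ρ X ≤ ρ Y
  pos_homogeneous : ∀ (c : ℝ≥0) (X : LinfPos P), ρ (c • X) = c * ρ X
  map_one : ρ (oneLinf P) = 1

/-- Convexity of `ρ` on the cone `L^∞_+`. -/
def IsConvex {P : Measure Ω} (ρ : LinfPos P → ℝ≥0) : Prop :=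
  ∀ (X Y : LinfPos P) (a b : ℝ≥0), a + b = 1 → ρ (a • X + b • Y) ≤ a * ρ X + b * ρ Y

/-- The Fatou property: lower semicontinuity along sequences that are bounded in `L^∞` and
converge in probability. -/
def FatouProperty {P : Measure Ω} (ρ : LinfPos P → ℝ≥0) : Prop :=
  ∀ (X : ℕ → LinfPos P) (Y : LinfPos P) (k : ℝ),
    TendstoInMeasure P (fun n => rv (X n)) atTop (rv Y) →
    (∀ n, ‖(X n : Lp ℝ ∞ P)‖ ≤ k) →
    (ρ Y : ℝ≥0∞) ≤ liminf (fun n => (ρ (X n) : ℝ≥0∞)) atTop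

/-- The Lebesgue property: continuity along sequences that are bounded in `L^∞` and converge in
probability. -/
def LebesgueProperty {P : Measure Ω} (ρ : LinfPos P → ℝ≥0) : Prop :=
  ∀ (X : ℕ → LinfPos P) (Y : LinfPos P) (k : ℝ),
    TendstoInMeasure P (fun n => rv (X n)) atTop (rv Y) →
    (∀ n, ‖(X n : Lp ℝ ∞ P)‖ ≤ k) →
    Tendsto (fun n => ρ (X n)) atTop (𝓝 (ρ Y))

/-- Law-invariance: `ρ X` depends only on the distribution of `X` under `P`. -/
def LawInvariant {P : Measure Ω} (ρ : LinfPos P → ℝ≥0) : Prop :=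
  ∀ X Y : LinfPos P, P.map (rv X) = P.map (rv Y) → ρ X = ρ Y

/-- The multiplicative acceptance set `B_ρ`. -/
def acceptanceSet {P : Measure Ω} (ρ : LinfPos P → ℝ≥0) : Set (LinfPos P) := {X | ρ X ≤ 1}

/-- The set of probability measures on `Ω` that are absolutely continuous with respect
to `P`. -/
def ACProb (P : Measure Ω) : Type _ := {Q : Measure Ω // IsProbabilityMeasure Q ∧ Q ≪ P}

/-- `E_Q[X]` for nonnegative `X`, with values in `[0, ∞]`. -/
noncomputable def expect {P : Measure Ω} (Q : ACProb P) (X : LinfPos P) : ℝ≥0∞ :=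
  ∫⁻ ω, ENNReal.ofReal (rv X ω) ∂Q.1

/-- The Radon–Nikodym density `dQ/dP` as a real random variable. -/
noncomputable def density {P : Measure Ω} (Q : ACProb P) : Ω → ℝ :=
  fun ω => (Q.1.rnDeriv P ω).toReal

/-- `β(Q) = [sup_{X ∈ B_ρ} E_Q[X]]⁻¹`, with `1 / ∞ = 0`. -/
noncomputable def beta {P : Measure Ω} (ρ : LinfPos P → ℝ≥0) (Q : ACProb P) : ℝ≥0∞ :=
  (⨆ X ∈ acceptanceSet ρ, expect Q X)⁻¹

/-- `q` is a version of the quantile function of `f` under `P`: for every level `t ∈ (0, 1)`,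
`P(f < q t) ≤ t ≤ P(f ≤ q t)`. -/
def IsQuantileFunction (P : Measure Ω) (f : Ω → ℝ) (q : ℝ → ℝ) : Prop :=
  ∀ t ∈ Ioo (0 : ℝ) 1,
    P.real {ω | f ω < q t} ≤ t ∧ t ≤ P.real {ω | f ω ≤ q t}

/-- `∫₀¹ q₁(t) q₂(t) dt` with values in `[0, ∞]`, for functions that are nonnegative on `(0, 1)`,
such as the quantile functions of nonnegative random variables. -/
noncomputable def quantileIntegral (q₁ q₂ : ℝ → ℝ) : ℝ≥0∞ :=
  ∫⁻ t in Ioo (0 : ℝ) 1, ENNReal.ofReal (q₁ t * q₂ t)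

end ReturnRisk

/-!
The dual representation, attainment under the Lebesgue property, and the quantile form for
law-invariant risk measures all reduce to finding measures in the polar of the acceptance set
`B_ρ`: a finite `ν ≪ P` with `∫ Y dν ≤ 1` for `Y ∈ B_ρ` normalizes to some `Q` with
`ν ≤ β(Q) • Q` (`exists_lintegral_le_beta_mul_expect`). Conversely `β(Q) E_Q[X] ≤ ρ X` follows from
positive homogeneity alone (`beta_mul_expect_le`).

*Representation.* Monotonicity makes `B_ρ` solid, which allows weak-star arguments in `L^∞` to be
replaced by Hilbert space ones: the set of `Y ∈ L²` all of whose truncations `(Y ∨ 0) ∧ n` belong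
to `B_ρ` is convex, is closed by the Fatou property, and meets `L^∞_+` in `B_ρ`. If `ρ X > 1`, a
separating functional on `L²` is given by some `Z ∈ L²`. Testing it against `Y 1_{Z > 0}`, which
is again acceptable by solidity, shows that the density `Z⁺` has the required property
(`exists_polar_measure`).

*Attainment.* The functional `Y ↦ ρ (Y⁺)` is sublinear on `L^∞`, so by Hahn–Banach it dominates a
linear functional `g` that agrees with `ρ` at the given `X`. Such a `g` is positive, and the
Lebesgue property makes it order continuous, hence integration against a measure
(`exists_measure_eq_lintegral`), which is in the polar.

*Quantiles.* The inequality `E_Q[X] ≤ ∫ q_X q_φ` is the Hardy–Littlewood inequality, obtained from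
the layer-cake formula and the nestedness of upper level sets of monotone functions
(`lintegral_mul_le_quantileIntegral`). On a nonatomic space the density is `q_φ ∘ U` for a uniform
`U` (`IsQuantileFunction.exists_uniform`), and the rearrangement `q_X ∘ U` of `X` attains the bound
(`exists_rearrangement`). It has the law of `X`, so `ρ` takes the same value there; hence neither
supremum changes when the expectations are replaced by quantile integrals.
-/

namespace ReturnRisk

section

variable {Ω : Type*} [MeasurableSpace Ω] {P : Measure Ω}

/-! ### Elements of `L^∞_+` and their representatives -/

lemma measurable_rv (X : LinfPos P) : Measurable (rv X) :=
  (Lp.stronglyMeasurable (X : Lp ℝ ∞ P)).measurable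

lemma rv_nonneg (X : LinfPos P) : 0 ≤ᵐ[P] rv X := (Lp.coeFn_nonneg (X : Lp ℝ ∞ P)).2 X.2

lemma memLp_rv (X : LinfPos P) : MemLp (rv X) ∞ P := Lp.memLp (X : Lp ℝ ∞ P)

lemma le_iff_rv_le {X Y : LinfPos P} : X ≤ Y ↔ rv X ≤ᵐ[P] rv Y :=
  (Lp.coeFn_le (X : Lp ℝ ∞ P) (Y : Lp ℝ ∞ P)).symm

lemma ext_rv {X Y : LinfPos P} (h : rv X =ᵐ[P] rv Y) : X = Y := Subtype.ext (Lp.ext h)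

lemma rv_add (X Y : LinfPos P) : rv (X + Y) =ᵐ[P] fun ω => rv X ω + rv Y ω :=
  Lp.coeFn_add (X : Lp ℝ ∞ P) (Y : Lp ℝ ∞ P)

lemma rv_smul (c : ℝ≥0) (X : LinfPos P) : rv (c • X) =ᵐ[P] fun ω => (c : ℝ) * rv X ω :=
  Lp.coeFn_smul (c : ℝ) (X : Lp ℝ ∞ P)

lemma rv_oneLinf [IsProbabilityMeasure P] : rv (oneLinf P) =ᵐ[P] fun _ => 1 :=
  Lp.coeFn_const ∞ P (1 : ℝ)

/-- The class in `L^∞_+` of an essentially bounded, almost surely nonnegative function. -/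
noncomputable def ofFun (f : Ω → ℝ) (hf : MemLp f ∞ P) (h0 : 0 ≤ᵐ[P] f) : LinfPos P :=
  ⟨hf.toLp f, by
    refine (Lp.coeFn_nonneg (hf.toLp f)).1 ?_
    filter_upwards [h0, hf.coeFn_toLp] with ω h h'
    rw [h']; exact h⟩

lemma rv_ofFun {f : Ω → ℝ} (hf : MemLp f ∞ P) (h0 : 0 ≤ᵐ[P] f) : rv (ofFun f hf h0) =ᵐ[P] f :=
  hf.coeFn_toLp

lemma ae_rv_le_norm (X : LinfPos P) : ∀ᵐ ω ∂P, rv X ω ≤ ‖(X : Lp ℝ ∞ P)‖ := by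
  filter_upwards [ae_le_eLpNormEssSup (f := rv X) (μ := P)] with ω h
  have hfin : eLpNorm (rv X) ∞ P ≠ ∞ := (memLp_rv X).2.ne
  rw [Lp.norm_def]
  refine (le_abs_self _).trans ?_
  rw [← Real.norm_eq_abs, ← toReal_enorm]
  refine ENNReal.toReal_mono hfin ?_
  rwa [eLpNorm_exponent_top]

lemma norm_le_of_rv_le [IsProbabilityMeasure P] {X : LinfPos P} {k : ℝ} (hk : 0 ≤ k)
    (h : ∀ᵐ ω ∂P, rv X ω ≤ k) : ‖(X : Lp ℝ ∞ P)‖ ≤ k := by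
  have := Lp.norm_le_of_ae_bound (f := (X : Lp ℝ ∞ P)) hk (by
    filter_upwards [h, rv_nonneg X] with ω h1 h2
    rw [Real.norm_eq_abs]
    exact abs_le.2 ⟨by simp only [Pi.zero_apply, rv] at h2; linarith, h1⟩)
  simpa using this

/-- The class of `(f ∨ 0) ∧ k`. -/
noncomputable def clamp [IsFiniteMeasure P] (k : ℝ≥0) (f : Ω → ℝ)
    (hf : AEStronglyMeasurable f P) : LinfPos P :=
  ofFun (fun ω => min (max (f ω) 0) k)
    (memLp_top_of_bound ((hf.sup aestronglyMeasurable_const).inf aestronglyMeasurable_const) k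
      (ae_of_all _ fun ω => by
        rw [Real.norm_eq_abs, abs_of_nonneg (le_min (le_max_right _ _) k.coe_nonneg)]
        exact min_le_right _ _))
    (ae_of_all _ fun ω => le_min (le_max_right _ _) k.coe_nonneg)

lemma rv_clamp [IsFiniteMeasure P] (k : ℝ≥0) {f : Ω → ℝ} (hf : AEStronglyMeasurable f P) :
    rv (clamp k f hf) =ᵐ[P] fun ω => min (max (f ω) 0) (k : ℝ) := rv_ofFun _ _

/-! ### Polar measures of the acceptance set -/

lemma expect_smul (Q : ACProb P) (c : ℝ≥0) (X : LinfPos P) :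
    expect Q (c • X) = c * expect Q X := by
  have hm : Measurable fun ω => ENNReal.ofReal (rv X ω) := (measurable_rv X).ennreal_ofReal
  rw [expect, expect, ← lintegral_const_mul _ hm]
  refine lintegral_congr_ae (Q.2.2.ae_le ?_)
  filter_upwards [rv_smul c X] with ω h
  rw [h, ENNReal.ofReal_mul c.coe_nonneg, ENNReal.ofReal_coe_nnreal]

variable [IsProbabilityMeasure P] {ρ : LinfPos P → ℝ≥0}

lemma IsReturnRiskMeasure.map_zero (hρ : IsReturnRiskMeasure ρ) : ρ 0 = 0 := by
  simpa using hρ.pos_homogeneous 0 0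

lemma one_le_iSup_expect (hρ : IsReturnRiskMeasure ρ) (Q : ACProb P) :
    1 ≤ ⨆ X ∈ acceptanceSet ρ, expect Q X := by
  have := Q.2.1
  refine le_iSup₂_of_le (oneLinf P) hρ.map_one.le ?_
  have : expect Q (oneLinf P) = ∫⁻ _, 1 ∂Q.1 :=
    lintegral_congr_ae (Q.2.2.ae_le (by
      filter_upwards [rv_oneLinf (P := P)] with ω h
      rw [h, ENNReal.ofReal_one]))
  rw [this]; simp

lemma beta_le_one (hρ : IsReturnRiskMeasure ρ) (Q : ACProb P) : beta ρ Q ≤ 1 :=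
  ENNReal.inv_le_one.2 (one_le_iSup_expect hρ Q)

lemma beta_mul_expect_le (hρ : IsReturnRiskMeasure ρ) (Q : ACProb P) (X : LinfPos P) :
    beta ρ Q * expect Q X ≤ ρ X := by
  set S := ⨆ Y ∈ acceptanceSet ρ, expect Q Y with hS
  have hS0 : S ≠ 0 := (zero_lt_one.trans_le (one_le_iSup_expect hρ Q)).ne'
  -- every `c > ρ X` makes `c⁻¹ X` acceptable; this covers `ρ X = 0` as well
  refine ENNReal.le_of_forall_pos_le_add fun ε hε _ => ?_
  have hc : 0 < ρ X + ε := by positivity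
  have hmem : (ρ X + ε)⁻¹ • X ∈ acceptanceSet ρ := by
    change ρ _ ≤ 1
    rw [hρ.pos_homogeneous, inv_mul_le_iff₀ hc]
    simp
  have h1 : ((ρ X + ε)⁻¹ : ℝ≥0) * expect Q X ≤ S := by
    rw [← expect_smul]
    exact le_iSup₂_of_le _ hmem le_rfl
  rw [ENNReal.coe_inv hc.ne', mul_comm, ← div_eq_mul_inv,
    ENNReal.div_le_iff (by exact_mod_cast hc.ne') ENNReal.coe_ne_top] at h1
  rw [beta, ← hS, mul_comm, ← div_eq_mul_inv]
  refine ENNReal.div_le_of_le_mul ?_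
  rw [mul_comm]
  simpa using h1

/-- A finite measure `ν ≪ P` in the polar of the acceptance set is dominated, after
normalization to a probability measure `Q`, by `β(Q) • Q`. -/
lemma exists_lintegral_le_beta_mul_expect (ν : Measure Ω) [IsFiniteMeasure ν] (hν : ν ≪ P)
    (hpol : ∀ Y ∈ acceptanceSet ρ, ∫⁻ ω, ENNReal.ofReal (rv Y ω) ∂ν ≤ 1) :
    ∃ Q : ACProb P, ∀ X : LinfPos P,
      ∫⁻ ω, ENNReal.ofReal (rv X ω) ∂ν ≤ beta ρ Q * expect Q X := by
  rcases eq_or_ne ν 0 with rfl | h0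
  · exact ⟨⟨P, inferInstance, Measure.AbsolutelyContinuous.rfl⟩, fun X => by simp⟩
  have hm0 : ν univ ≠ 0 := by simpa using h0
  have hmt : ν univ ≠ ∞ := measure_ne_top _ _
  have : NeZero ν := ⟨h0⟩
  let Q : ACProb P := ⟨(ν univ)⁻¹ • ν, inferInstance,
    (Measure.smul_absolutelyContinuous).trans hν⟩
  have hE : ∀ X, expect Q X = (ν univ)⁻¹ * ∫⁻ ω, ENNReal.ofReal (rv X ω) ∂ν := fun X => by
    change ∫⁻ ω, ENNReal.ofReal (rv X ω) ∂((ν univ)⁻¹ • ν) = _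
    rw [lintegral_smul_measure, smul_eq_mul]
  have hb : ν univ ≤ beta ρ Q := by
    rw [beta, ENNReal.le_inv_iff_le_inv]
    refine iSup₂_le fun Y hY => ?_
    rw [hE]
    exact mul_le_of_le_one_right' (hpol Y hY)
  refine ⟨Q, fun X => ?_⟩
  calc ∫⁻ ω, ENNReal.ofReal (rv X ω) ∂ν = ν univ * expect Q X := by
        rw [hE, ← mul_assoc, ENNReal.mul_inv_cancel hm0 hmt, one_mul]
    _ ≤ _ := by gcongr

end

section

/-! ### The dual representation -/

variable {Ω : Type*} [MeasurableSpace Ω] {P : Measure Ω} [IsProbabilityMeasure P]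
  {ρ : LinfPos P → ℝ≥0}

/-- The extension of the acceptance set to `L²`: all `Y` whose truncations `(Y ∨ 0) ∧ n` are
acceptable. -/
def acceptanceSetL2 (ρ : LinfPos P → ℝ≥0) : Set (Lp ℝ 2 P) :=
  {Y | ∀ n : ℕ, ρ (clamp n Y (Lp.aestronglyMeasurable Y)) ≤ 1}

lemma mem_acceptanceSetL2_of_le (hρ : IsReturnRiskMeasure ρ) {X : LinfPos P} (hX : ρ X ≤ 1)
    {Y : Lp ℝ 2 P} (h : Y ≤ᵐ[P] rv X) : Y ∈ acceptanceSetL2 ρ := fun n => by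
  refine (hρ.mono _ X (le_iff_rv_le.2 ?_)).trans hX
  filter_upwards [rv_clamp n (Lp.aestronglyMeasurable Y), h, rv_nonneg X] with ω h1 h2 h3
  rw [h1]
  exact (min_le_left _ _).trans (max_le h2 h3)

lemma convex_acceptanceSetL2 (hρ : IsReturnRiskMeasure ρ) (hconv : IsConvex ρ) :
    Convex ℝ (acceptanceSetL2 ρ) := by
  refine convex_iff_forall_pos.2 fun Y hY Y' hY' a b ha hb hab n => ?_
  lift a to ℝ≥0 using ha.le
  lift b to ℝ≥0 using hb.le
  -- at a level `m` this high, one truncated summand alone reaches `n`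
  obtain ⟨m, hm⟩ := exists_nat_ge (max ((n : ℝ) / a) (n / b))
  have ham : (n : ℝ) ≤ a * m := by
    have := (div_le_iff₀ ha).1 ((le_max_left _ _).trans hm); linarith
  have hbm : (n : ℝ) ≤ b * m := by
    have := (div_le_iff₀ hb).1 ((le_max_right _ _).trans hm); linarith
  set Z := clamp m Y (Lp.aestronglyMeasurable Y)
  set Z' := clamp m Y' (Lp.aestronglyMeasurable Y')
  have hle : clamp n ((a : ℝ) • Y + (b : ℝ) • Y' : Lp ℝ 2 P) (Lp.aestronglyMeasurable _)
      ≤ a • Z + b • Z' := by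
    refine le_iff_rv_le.2 ?_
    filter_upwards [rv_clamp n (Lp.aestronglyMeasurable ((a : ℝ) • Y + (b : ℝ) • Y' : Lp ℝ 2 P)),
      rv_clamp m (Lp.aestronglyMeasurable Y), rv_clamp m (Lp.aestronglyMeasurable Y'),
      rv_add (a • Z) (b • Z'), rv_smul a Z, rv_smul b Z', Lp.coeFn_add ((a : ℝ) • Y) ((b : ℝ) • Y'),
      Lp.coeFn_smul (a : ℝ) Y, Lp.coeFn_smul (b : ℝ) Y'] with ω h1 h2 h3 h4 h5 h6 h7 h8 h9
    rw [h1, h4, h5, h6, h2, h3, h7, Pi.add_apply, h8, h9]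
    simp only [Pi.smul_apply, smul_eq_mul, NNReal.coe_natCast]
    have hn : (0 : ℝ) ≤ n := n.cast_nonneg
    have hm0 : (0 : ℝ) ≤ m := m.cast_nonneg
    have p1 : 0 ≤ (a : ℝ) * min (max (Y ω) 0) m := by positivity
    have p2 : 0 ≤ (b : ℝ) * min (max (Y' ω) 0) m := by positivity
    rcases le_total (max (Y ω) 0) m with k1 | k1
    · rcases le_total (max (Y' ω) 0) m with k2 | k2
      · refine (min_le_left _ _).trans (max_le ?_ (by linarith))
        rw [min_eq_left k1, min_eq_left k2]
        gcongr <;> exact le_max_left _ _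
      · refine (min_le_right _ _).trans ?_
        rw [min_eq_right k2]; linarith
    · refine (min_le_right _ _).trans ?_
      rw [min_eq_right k1]; linarith
  have habN : a + b = 1 := by exact_mod_cast hab
  calc _ ≤ ρ (a • Z + b • Z') := hρ.mono _ _ hle
    _ ≤ a * ρ Z + b * ρ Z' := hconv _ _ _ _ habN
    _ ≤ a * 1 + b * 1 := by gcongr; exacts [hY m, hY' m]
    _ = 1 := by rw [mul_one, mul_one, habN]

lemma isClosed_acceptanceSetL2 (hFatou : FatouProperty ρ) : IsClosed (acceptanceSetL2 ρ) := by
  refine IsSeqClosed.isClosed fun Y Y₀ hY hlim n => ?_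
  have hconv := tendstoInMeasure_of_tendsto_Lp hlim
  have key : TendstoInMeasure P
      (fun j => rv (clamp n (Y j) (Lp.aestronglyMeasurable (Y j)))) atTop
      (rv (clamp n Y₀ (Lp.aestronglyMeasurable Y₀))) := by
    -- truncation is a contraction, so it preserves convergence in measure
    intro ε hε
    refine tendsto_of_tendsto_of_tendsto_of_le_of_le tendsto_const_nhds (hconv ε hε)
      (fun _ => zero_le) fun j => ?_
    refine measure_mono_ae ?_
    filter_upwards [rv_clamp n (Lp.aestronglyMeasurable (Y j)),
      rv_clamp n (Lp.aestronglyMeasurable Y₀)] with ω h1 h2 (h3 : ε ≤ edist _ _)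
    refine h3.trans ?_
    rw [h1, h2, edist_dist, edist_dist, Real.dist_eq, Real.dist_eq]
    refine ENNReal.ofReal_le_ofReal ?_
    refine (abs_min_sub_min_le_max _ _ _ _).trans ?_
    rw [sub_self, abs_zero, max_eq_left (abs_nonneg _)]
    refine (abs_max_sub_max_le_max _ _ _ _).trans ?_
    rw [sub_self, abs_zero, max_eq_left (abs_nonneg _)]
  have := hFatou _ _ n key fun j => norm_le_of_rv_le n.cast_nonneg (by
    filter_upwards [rv_clamp n (Lp.aestronglyMeasurable (Y j))] with ω h1
    rw [h1]; exact min_le_right _ _)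
  have h1 : liminf (fun j => (ρ (clamp n (Y j) (Lp.aestronglyMeasurable (Y j))) : ℝ≥0∞)) atTop
      ≤ liminf (fun _ => (1 : ℝ≥0∞)) (atTop : Filter ℕ) :=
    liminf_le_liminf (Eventually.of_forall fun j => by exact_mod_cast hY j n)
  rw [liminf_const] at h1
  exact_mod_cast this.trans h1

/-- Bipolar theorem for the acceptance set: an element outside it is separated from it by a
finite measure `ν ≪ P`. -/
lemma exists_polar_measure (hρ : IsReturnRiskMeasure ρ) (hconv : IsConvex ρ)
    (hFatou : FatouProperty ρ) {X : LinfPos P} (hX : 1 < ρ X) :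
    ∃ ν : Measure Ω, IsFiniteMeasure ν ∧ ν ≪ P ∧
      (∀ Y ∈ acceptanceSet ρ, ∫⁻ ω, ENNReal.ofReal (rv Y ω) ∂ν ≤ 1) ∧
      1 ≤ ∫⁻ ω, ENNReal.ofReal (rv X ω) ∂ν := by
  have hL2 : ∀ Y : LinfPos P, MemLp (rv Y) 2 P := fun Y => (memLp_rv Y).mono_exponent le_top
  set x : Lp ℝ 2 P := (hL2 X).toLp with hx
  have hxC : x ∉ acceptanceSetL2 ρ := fun h => by
    obtain ⟨n, hn⟩ := exists_nat_ge ‖(X : Lp ℝ ∞ P)‖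
    have : clamp n x (Lp.aestronglyMeasurable x) = X := by
      refine ext_rv ?_
      filter_upwards [rv_clamp n (Lp.aestronglyMeasurable x), (hL2 X).coeFn_toLp, rv_nonneg X,
        ae_rv_le_norm X] with ω h1 h2 h3 h4
      rw [h1, hx, h2, max_eq_left (by exact h3), min_eq_left]
      exact h4.trans hn
    exact absurd (this ▸ h n) (not_le.2 hX)
  obtain ⟨f, u, hfC, hfx⟩ := geometric_hahn_banach_closed_point
    (convex_acceptanceSetL2 hρ hconv) (isClosed_acceptanceSetL2 hFatou) hxC
  have hu : 0 < u := by
    have h0 : (0 : Lp ℝ 2 P) ∈ acceptanceSetL2 ρ :=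
      mem_acceptanceSetL2_of_le hρ (X := 0) (by simp [hρ.map_zero]) (by
        filter_upwards [Lp.coeFn_zero ℝ 2 P, rv_nonneg (0 : LinfPos P)] with ω h h'
        rw [h]; exact h')
    simpa using hfC 0 h0
  set Z : Lp ℝ 2 P := u⁻¹ • (InnerProductSpace.toDual ℝ (Lp ℝ 2 P)).symm f with hZ
  have hZf : ∀ y : Lp ℝ 2 P, ∫ ω, Z ω * y ω ∂P = u⁻¹ * f y := fun y => by
    rw [← InnerProductSpace.toDual_symm_apply (𝕜 := ℝ) (x := y) (y := f), ← real_inner_smul_left,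
      ← hZ, L2.inner_def]
    refine integral_congr_ae (ae_of_all _ fun ω => ?_)
    simp [mul_comm]
  have hZm : Measurable Z := (Lp.stronglyMeasurable Z).measurable
  have hZi : Integrable Z P := (Lp.memLp Z).integrable (by norm_num)
  have hlint : ∀ Y : LinfPos P, ∫⁻ ω, ENNReal.ofReal (rv Y ω)
      ∂(P.withDensity fun ω => ENNReal.ofReal (Z ω)) = ∫⁻ ω, ENNReal.ofReal (Z ω * rv Y ω) ∂P := by
    intro Y
    rw [lintegral_withDensity_eq_lintegral_mul _ hZm.ennreal_ofReal
      (measurable_rv Y).ennreal_ofReal]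
    refine lintegral_congr_ae ?_
    filter_upwards [rv_nonneg Y] with ω h
    rw [Pi.mul_apply, ENNReal.ofReal_mul' h]
  refine ⟨P.withDensity fun ω => ENNReal.ofReal (Z ω), ?_, withDensity_absolutelyContinuous _ _,
    fun Y hY => ?_, ?_⟩
  · exact isFiniteMeasure_withDensity_ofReal hZi.2
  · rw [hlint]
    -- testing against `Y` on the set where `Z` is positive replaces `Z` by its positive part
    have hA : MeasurableSet {ω | 0 < Z ω} := measurableSet_lt measurable_const hZm
    have hYA : MemLp ({ω | 0 < Z ω}.indicator (rv Y)) 2 P := (hL2 Y).indicator hA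
    have hmem : hYA.toLp _ ∈ acceptanceSetL2 ρ := mem_acceptanceSetL2_of_le hρ hY (by
      filter_upwards [hYA.coeFn_toLp, rv_nonneg Y] with ω h h'
      rw [h]; exact indicator_le_self' (fun _ _ => h') ω)
    have hint : Integrable (fun ω => Z ω * hYA.toLp _ ω) P :=
      (Lp.memLp Z).integrable_mul (Lp.memLp (hYA.toLp _))
    have h1 : ∫ ω, Z ω * hYA.toLp _ ω ∂P ≤ 1 := by
      rw [hZf, inv_mul_le_iff₀ hu, mul_one]
      exact (hfC _ hmem).le
    have h2 : ∫⁻ ω, ENNReal.ofReal (Z ω * rv Y ω) ∂P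
        = ∫⁻ ω, ENNReal.ofReal (Z ω * hYA.toLp _ ω) ∂P := by
      refine lintegral_congr_ae ?_
      filter_upwards [hYA.coeFn_toLp, rv_nonneg Y] with ω h h'
      rw [h]
      by_cases hω : 0 < Z ω
      · rw [indicator_of_mem (by exact hω)]
      · rw [indicator_of_notMem (by exact hω), mul_zero, ENNReal.ofReal_zero,
          ENNReal.ofReal_eq_zero]
        exact mul_nonpos_of_nonpos_of_nonneg (not_lt.1 hω) h'
    rw [h2, ← ofReal_integral_eq_lintegral_ofReal hint, ← ENNReal.ofReal_one]
    · exact ENNReal.ofReal_le_ofReal h1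
    · filter_upwards [hYA.coeFn_toLp, rv_nonneg Y] with ω h h'
      rw [h]
      by_cases hω : 0 < Z ω
      · rw [indicator_of_mem (by exact hω)]
        exact mul_nonneg hω.le h'
      · rw [indicator_of_notMem (by exact hω), mul_zero]; rfl
  · rw [hlint]
    have h1 : 1 ≤ ∫ ω, Z ω * x ω ∂P := by
      rw [hZf, le_inv_mul_iff₀ hu, mul_one]
      exact hfx.le
    have h2 : ∫ ω, Z ω * x ω ∂P = ∫ ω, Z ω * rv X ω ∂P := integral_congr_ae (by
      filter_upwards [(hL2 X).coeFn_toLp] with ω h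
      rw [hx, h])
    rw [h2] at h1
    have hint : Integrable (fun ω => Z ω * rv X ω) P := (Lp.memLp Z).integrable_mul (hL2 X)
    rw [integral_eq_lintegral_pos_part_sub_lintegral_neg_part hint] at h1
    rw [← ENNReal.ofReal_one]
    refine ENNReal.ofReal_le_of_le_toReal (h1.trans (sub_le_self _ ENNReal.toReal_nonneg))

/-- Dual representation: applying the bipolar theorem to `X / r` for every `r < ρ X` exhausts
`ρ X`. -/
theorem eq_iSup_beta_mul_expect (hρ : IsReturnRiskMeasure ρ) (hconv : IsConvex ρ)
    (hFatou : FatouProperty ρ) (X : LinfPos P) :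
    (ρ X : ℝ≥0∞) = ⨆ Q : ACProb P, beta ρ Q * expect Q X := by
  refine le_antisymm ?_ (iSup_le fun Q => beta_mul_expect_le hρ Q X)
  refine ENNReal.le_of_forall_nnreal_lt fun r hr => ?_
  rcases eq_or_ne r 0 with rfl | hr0
  · simp
  have hr' : r < ρ X := by exact_mod_cast hr
  obtain ⟨ν, _, hac, hpol, h1⟩ := exists_polar_measure hρ hconv hFatou (X := r⁻¹ • X) (by
    rw [hρ.pos_homogeneous, lt_inv_mul_iff₀ (pos_iff_ne_zero.2 hr0), mul_one]; exact hr')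
  obtain ⟨Q, hQ⟩ := exists_lintegral_le_beta_mul_expect ν hac hpol
  refine le_iSup_of_le Q ?_
  have h2 := h1.trans (hQ _)
  rw [expect_smul, ENNReal.coe_inv hr0, mul_left_comm, mul_comm, ← div_eq_mul_inv,
    ENNReal.le_div_iff_mul_le (by simp [hr0]) (by simp), one_mul] at h2
  exact h2

end

section

/-! ### Attainment under the Lebesgue property -/

variable {Ω : Type*} [MeasurableSpace Ω] {P : Measure Ω} [IsProbabilityMeasure P]
  {ρ : LinfPos P → ℝ≥0}

lemma IsReturnRiskMeasure.map_add_le (hρ : IsReturnRiskMeasure ρ) (hconv : IsConvex ρ)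
    (X Y : LinfPos P) : ρ (X + Y) ≤ ρ X + ρ Y := by
  have h := hconv ((2 : ℝ≥0) • X) ((2 : ℝ≥0) • Y) 2⁻¹ 2⁻¹ (by
    rw [← two_mul]; exact mul_inv_cancel₀ two_ne_zero)
  simpa [hρ.pos_homogeneous] using h

/-- The positive part of an element of `L^∞`. -/
noncomputable def posPartLinf (Y : Lp ℝ ∞ P) : LinfPos P := 
  ⟨Y ⊔ 0, (le_sup_right : (0 : Lp ℝ ∞ P) ≤ Y ⊔ 0)⟩

omit [IsProbabilityMeasure P] in
lemma rv_posPartLinf (Y : Lp ℝ ∞ P) : rv (posPartLinf Y) =ᵐ[P] fun ω => max (Y ω) 0 := by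
  filter_upwards [Lp.coeFn_sup Y 0, Lp.coeFn_zero ℝ ∞ P] with ω h h'
  rw [rv, posPartLinf, h, Pi.sup_apply, h']
  rfl

omit [IsProbabilityMeasure P] in
lemma posPartLinf_coe (X : LinfPos P) : posPartLinf (X : Lp ℝ ∞ P) = X :=
  Subtype.ext (sup_eq_left.2 (show (0 : Lp ℝ ∞ P) ≤ X from X.2))

/-- Hahn–Banach: a positive linear functional on `L^∞` dominated by `ρ` on `L^∞_+` and equal to it
at `X`. -/
lemma exists_linearMap_le (hρ : IsReturnRiskMeasure ρ) (hconv : IsConvex ρ) (X : LinfPos P) :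
    ∃ g : Lp ℝ ∞ P →ₗ[ℝ] ℝ, g X = ρ X ∧ (∀ Y : LinfPos P, 0 ≤ g Y) ∧
      ∀ Y : LinfPos P, g Y ≤ ρ Y := by
  -- a linear functional below the sublinear functional `Y ↦ ρ (Y⁺)` is automatically positive
  have hneg : ∀ Y : LinfPos P, posPartLinf (-(Y : Lp ℝ ∞ P)) = 0 := fun Y =>
    Subtype.ext (sup_eq_right.2 (neg_nonpos.2 (show (0 : Lp ℝ ∞ P) ≤ Y from Y.2)))
  have hhom : ∀ c : ℝ, 0 < c → ∀ Y : Lp ℝ ∞ P,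
      (ρ (posPartLinf (c • Y)) : ℝ) = c * ρ (posPartLinf Y) := by
    intro c hc Y
    lift c to ℝ≥0 using hc.le
    have : posPartLinf ((c : ℝ) • Y) = c • posPartLinf Y := by
      refine ext_rv ?_
      filter_upwards [rv_posPartLinf ((c : ℝ) • Y), rv_smul c (posPartLinf Y), rv_posPartLinf Y,
        Lp.coeFn_smul (c : ℝ) Y] with ω h1 h2 h3 h4
      rw [h1, h2, h3, h4, Pi.smul_apply, smul_eq_mul, mul_max_of_nonneg _ _ c.coe_nonneg, mul_zero]
    rw [this, hρ.pos_homogeneous]; push_cast; rfl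
  have hadd : ∀ Y Z : Lp ℝ ∞ P,
      (ρ (posPartLinf (Y + Z)) : ℝ) ≤ ρ (posPartLinf Y) + ρ (posPartLinf Z) := by
    intro Y Z
    have h1 : posPartLinf (Y + Z) ≤ posPartLinf Y + posPartLinf Z :=
      sup_le (add_le_add (le_sup_left (a := Y) (b := 0)) (le_sup_left (a := Z) (b := 0)))
        (add_nonneg (le_sup_right (a := Y)) (le_sup_right (a := Z)))
    exact_mod_cast (hρ.mono _ _ h1).trans (hρ.map_add_le hconv _ _)
  have main : ∃ g : Lp ℝ ∞ P →ₗ[ℝ] ℝ, g X = ρ X ∧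
      ∀ Y : Lp ℝ ∞ P, g Y ≤ ρ (posPartLinf Y) := by
    rcases eq_or_ne (X : Lp ℝ ∞ P) 0 with h0 | h0
    · refine ⟨0, ?_, fun Y => by simp⟩
      have : X = 0 := Subtype.ext h0
      rw [this, hρ.map_zero]; simp
    · obtain ⟨g, hg1, hg2⟩ := exists_extension_of_le_sublinear
        (LinearPMap.mkSpanSingleton (X : Lp ℝ ∞ P) (ρ X : ℝ) h0)
        (fun Y => (ρ (posPartLinf Y) : ℝ)) hhom hadd (by
          rintro ⟨y, hy⟩
          obtain ⟨c, rfl⟩ := Submodule.mem_span_singleton.1 hy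
          rw [LinearPMap.mkSpanSingleton'_apply, RingHom.id_apply, smul_eq_mul]
          rcases lt_or_ge 0 c with hc | hc
          · exact (by rw [hhom c hc, posPartLinf_coe])
          · exact (mul_nonpos_of_nonpos_of_nonneg hc (ρ X).coe_nonneg).trans
              (NNReal.coe_nonneg _))
      refine ⟨g, ?_, hg2⟩
      have := hg1 ⟨(X : Lp ℝ ∞ P), Submodule.mem_span_singleton_self _⟩
      rw [this]
      exact LinearPMap.mkSpanSingleton_apply ℝ ℝ h0 (ρ X : ℝ)
  obtain ⟨g, hgX, hg⟩ := main
  refine ⟨g, hgX, fun Y => ?_, fun Y => by simpa [posPartLinf_coe] using hg Y⟩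
  have := hg (-(Y : Lp ℝ ∞ P))
  rw [hneg, hρ.map_zero, map_neg] at this
  simpa using this

omit [IsProbabilityMeasure P] in
/-- A measurable function between `0` and an element `Y` of `L^∞_+` splits `Y` in `L^∞_+`. -/
lemma exists_add_eq_of_le {f : Ω → ℝ≥0∞} (hf : Measurable f) {Y : LinfPos P}
    (h : f ≤ᵐ[P] fun ω => ENNReal.ofReal (rv Y ω)) :
    ∃ W D : LinfPos P, (W : Lp ℝ ∞ P) + D = Y ∧ (fun ω => ENNReal.ofReal (rv W ω)) =ᵐ[P] f ∧
      rv D =ᵐ[P] fun ω => rv Y ω - (f ω).toReal := by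
  have hle : ∀ᵐ ω ∂P, (f ω).toReal ≤ rv Y ω := by
    filter_upwards [h, rv_nonneg Y] with ω h1 h2
    exact ENNReal.toReal_le_of_le_ofReal h2 h1
  have hW : MemLp (fun ω => (f ω).toReal) ∞ P :=
    (memLp_rv Y).of_le hf.ennreal_toReal.aestronglyMeasurable (by
      filter_upwards [hle] with ω h1
      rw [Real.norm_of_nonneg ENNReal.toReal_nonneg]
      exact h1.trans (le_abs_self _))
  have hD : MemLp (fun ω => rv Y ω - (f ω).toReal) ∞ P := (memLp_rv Y).sub hW
  refine ⟨ofFun _ hW (ae_of_all _ fun _ => ENNReal.toReal_nonneg),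
    ofFun _ hD (by filter_upwards [hle] with ω h1 using sub_nonneg.2 h1), ?_, ?_, rv_ofFun _ _⟩
  · change hW.toLp _ + hD.toLp _ = _
    refine Lp.ext ?_
    filter_upwards [Lp.coeFn_add (hW.toLp _) (hD.toLp _), hW.coeFn_toLp, hD.coeFn_toLp]
      with ω h1 h2 h3
    rw [h1, Pi.add_apply, h2, h3]
    exact add_sub_cancel _ _
  · filter_upwards [rv_ofFun hW (ae_of_all _ fun _ => ENNReal.toReal_nonneg), h] with ω h1 h2
    rw [h1, ENNReal.ofReal_toReal (ne_top_of_le_ne_top ENNReal.ofReal_ne_top h2)]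

/-- The indicator of a measurable set as an element of `L^∞_+`. -/
noncomputable def indLinf (P : Measure Ω) [IsFiniteMeasure P] (s : Set Ω) (hs : MeasurableSet s) :
    LinfPos P :=
  ofFun (s.indicator 1) (memLp_indicator_const ∞ hs (1 : ℝ) (Or.inr (measure_ne_top _ _)))
    (ae_of_all _ fun ω => indicator_nonneg (fun _ _ => zero_le_one) ω)

lemma rv_indLinf {s : Set Ω} (hs : MeasurableSet s) :
    rv (indLinf P s hs) =ᵐ[P] s.indicator 1 := rv_ofFun _ _

/-- A positive linear functional on `L^∞` that is order continuous at `0` is integration against a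
finite measure `ν ≪ P`. -/
lemma exists_measure_eq_lintegral (g : Lp ℝ ∞ P →ₗ[ℝ] ℝ) (hpos : ∀ Y : LinfPos P, 0 ≤ g Y)
    (hcont : ∀ (X : ℕ → LinfPos P) (Y : LinfPos P), (∀ n, X n ≤ Y) →
      (∀ᵐ ω ∂P, Tendsto (fun n => rv (X n) ω) atTop (𝓝 0)) →
      Tendsto (fun n => g (X n)) atTop (𝓝 0)) :
    ∃ ν : Measure Ω, IsFiniteMeasure ν ∧ ν ≪ P ∧
      ∀ Y : LinfPos P, ENNReal.ofReal (g Y) = ∫⁻ ω, ENNReal.ofReal (rv Y ω) ∂ν := by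
  have hnull : ∀ s (hs : MeasurableSet s), P s = 0 → g (indLinf P s hs) = 0 := fun s hs h => by
    have : indLinf P s hs = 0 := ext_rv (by
      filter_upwards [rv_indLinf (P := P) hs, Lp.coeFn_zero ℝ ∞ P,
        measure_eq_zero_iff_ae_notMem.1 h]
        with ω h1 h2 h3
      rw [h1, indicator_of_notMem h3]; exact h2.symm)
    rw [this]; exact map_zero g
  have hunion : ∀ ⦃f : ℕ → Set Ω⦄ (hf : ∀ i, MeasurableSet (f i)),
      Pairwise (Function.onFun Disjoint f) →
      ENNReal.ofReal (g (indLinf P (⋃ i, f i) (MeasurableSet.iUnion hf)))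
        = ∑' i, ENNReal.ofReal (g (indLinf P (f i) (hf i))) := by
    intro f hf hd
    have hR : ∀ n, MeasurableSet (⋃ i ∈ Ici n, f i) := fun n =>
      MeasurableSet.biUnion (to_countable _) fun i _ => hf i
    have hstep : ∀ n, g (indLinf P (f n) (hf n))
        = g (indLinf P _ (hR n)) - g (indLinf P _ (hR (n + 1))) := by
      intro n
      rw [eq_sub_iff_add_eq, ← map_add]
      congr 1
      refine Lp.ext ?_
      filter_upwards [rv_indLinf (P := P) (hf n), rv_indLinf (P := P) (hR n),
        rv_indLinf (P := P) (hR (n + 1)),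
        Lp.coeFn_add (indLinf P _ (hf n) : Lp ℝ ∞ P) (indLinf P _ (hR (n + 1)))]
        with ω h1 h2 h3 h4
      rw [h4]
      simp only [rv] at h1 h2 h3
      rw [Pi.add_apply, h1, h2, h3]
      have hU : (⋃ i ∈ Ici n, f i) = f n ∪ ⋃ i ∈ Ici (n + 1), f i := by
        have : Ici n = insert n (Ici (n + 1)) := by
          ext i; simp only [mem_Ici, mem_insert_iff]; omega
        rw [this, biUnion_insert]
      have hdis : Disjoint (f n) (⋃ i ∈ Ici (n + 1), f i) :=
        disjoint_iUnion₂_right.2 fun i hi => hd (by simp only [mem_Ici] at hi; omega)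
      rw [hU, indicator_union_of_disjoint hdis]
    have hlim : Tendsto (fun n => g (indLinf P _ (hR n))) atTop (𝓝 0) := by
      refine hcont _ (indLinf P univ MeasurableSet.univ) (fun n => le_iff_rv_le.2 ?_) ?_
      · filter_upwards [rv_indLinf (P := P) (hR n), rv_indLinf (P := P) MeasurableSet.univ]
          with ω h1 h2
        rw [h1, h2]
        exact indicator_le_indicator_of_subset (subset_univ _) (fun _ => zero_le_one) ω
      · filter_upwards [ae_all_iff.2 fun n => rv_indLinf (P := P) (hR n)] with ω h
        simp_rw [h]
        -- a point lies in at most one of the sets, so eventually in none of the tails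
        by_cases hω : ∃ i, ω ∈ f i
        · obtain ⟨i, hi⟩ := hω
          refine tendsto_const_nhds.congr' ?_
          filter_upwards [eventually_gt_atTop i] with n hn
          rw [indicator_of_notMem]
          simp only [mem_iUnion, not_exists]
          intro j hj hωj
          exact (hd (show i ≠ j from (hn.trans_le hj).ne)).le_bot ⟨hi, hωj⟩
        · refine tendsto_const_nhds.congr fun n => ?_
          rw [indicator_of_notMem]
          simp only [mem_iUnion, not_exists]
          exact fun j _ hωj => hω ⟨j, hωj⟩
    have hsum : ∀ n, ∑ i ∈ Finset.range n, ENNReal.ofReal (g (indLinf P (f i) (hf i)))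
        = ENNReal.ofReal (g (indLinf P _ (hR 0)) - g (indLinf P _ (hR n))) := fun n => by
      rw [← ENNReal.ofReal_sum_of_nonneg fun i _ => hpos _]
      simp_rw [hstep]
      rw [Finset.sum_range_sub']
    have h1 := ENNReal.tendsto_nat_tsum fun i => ENNReal.ofReal (g (indLinf P (f i) (hf i)))
    simp_rw [hsum] at h1
    have h2 := ENNReal.tendsto_ofReal ((tendsto_const_nhds (x := g (indLinf P _ (hR 0)))).sub hlim)
    rw [sub_zero] at h2
    rw [← tendsto_nhds_unique h2 h1]
    congr 3
    simp
  set ν : Measure Ω := Measure.ofMeasurable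
    (fun s hs => ENNReal.ofReal (g (indLinf P s hs)))
    (by rw [hnull _ _ measure_empty, ENNReal.ofReal_zero]) hunion with hν
  have hνs : ∀ s (hs : MeasurableSet s), ν s = ENNReal.ofReal (g (indLinf P s hs)) :=
    fun s hs => Measure.ofMeasurable_apply s hs
  have hac : ν ≪ P := Measure.AbsolutelyContinuous.mk fun s hs h => by
    rw [hνs s hs, hnull s hs h, ENNReal.ofReal_zero]
  refine ⟨ν, ⟨by rw [hνs _ MeasurableSet.univ]; exact ENNReal.ofReal_lt_top⟩, hac, ?_⟩
  suffices H : ∀ f : Ω → ℝ≥0∞, Measurable f → ∀ Y : LinfPos P,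
      (fun ω => ENNReal.ofReal (rv Y ω)) =ᵐ[P] f → ENNReal.ofReal (g Y) = ∫⁻ ω, f ω ∂ν from
    fun Y => H _ (measurable_rv Y).ennreal_ofReal Y EventuallyEq.rfl
  intro f hf
  refine Measurable.ennreal_induction (motive := fun f => ∀ Y : LinfPos P,
    (fun ω => ENNReal.ofReal (rv Y ω)) =ᵐ[P] f → ENNReal.ofReal (g Y) = ∫⁻ ω, f ω ∂ν) ?_ ?_ ?_ hf
  · intro c s hs Y hY
    rw [lintegral_indicator_const hs, hνs s hs]
    rcases eq_or_ne (P s) 0 with h0 | h0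
    · have : Y = 0 := ext_rv (by
        filter_upwards [hY, rv_nonneg Y, measure_eq_zero_iff_ae_notMem.1 h0, Lp.coeFn_zero ℝ ∞ P]
          with ω h1 h2 h3 h4
        rw [indicator_of_notMem h3, ENNReal.ofReal_eq_zero] at h1
        exact (le_antisymm h1 h2).trans h4.symm)
      rw [this, hnull s hs h0]; simp
    · have hc : c ≠ ∞ := by
        rintro rfl
        refine h0 (measure_eq_zero_iff_ae_notMem.2 ?_)
        filter_upwards [hY] with ω h1 h2
        rw [indicator_of_mem h2] at h1
        exact ENNReal.ofReal_ne_top h1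
      lift c to ℝ≥0 using hc
      have : Y = c • indLinf P s hs := ext_rv (by
        filter_upwards [hY, rv_nonneg Y, rv_smul c (indLinf P s hs), rv_indLinf (P := P) hs]
          with ω h1 h2 h3 h4
        rw [h3, h4, ← ENNReal.toReal_ofReal h2, h1]
        by_cases hω : ω ∈ s <;> simp [hω])
      have h2 : g Y = c * g (indLinf P s hs) := by
        rw [this]; exact map_smul g (c : ℝ) _
      rw [h2, ENNReal.ofReal_mul c.coe_nonneg, ENNReal.ofReal_coe_nnreal]
  · intro f₁ f₂ _ hf₁ hf₂ ih₁ ih₂ Y hY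
    obtain ⟨W, D, hWD, hW, hD⟩ := exists_add_eq_of_le hf₁ (Y := Y) (by
      filter_upwards [hY] with ω h1
      rw [h1]; exact le_self_add)
    rw [← hWD, map_add, ENNReal.ofReal_add (hpos W) (hpos D), ih₁ W hW, ih₂ D ?_]
    · exact (lintegral_add_left hf₁ _).symm
    · filter_upwards [hD, hY, rv_nonneg Y] with ω h1 h2 h3
      have hfin : f₁ ω + f₂ ω ≠ ∞ := by
        rw [← Pi.add_apply, ← h2]; exact ENNReal.ofReal_ne_top
      rw [h1, ← ENNReal.toReal_ofReal h3, h2, Pi.add_apply,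
        ENNReal.toReal_add (ENNReal.add_ne_top.1 hfin).1 (ENNReal.add_ne_top.1 hfin).2,
        add_sub_cancel_left, ENNReal.ofReal_toReal (ENNReal.add_ne_top.1 hfin).2]
  · intro f hf hmono ih Y hY
    choose W D hWD hW hD using fun n => exists_add_eq_of_le (hf n) (Y := Y) (by
      filter_upwards [hY] with ω h1
      rw [h1]; exact le_iSup (fun n => f n ω) n)
    have hD0 : Tendsto (fun n => g (D n)) atTop (𝓝 0) := by
      refine hcont D Y (fun n => ?_) ?_
      · have : (D n : Lp ℝ ∞ P) ≤ W n + D n := le_add_of_nonneg_left (W n).2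
        rwa [hWD] at this
      · filter_upwards [ae_all_iff.2 hD, hY, rv_nonneg Y] with ω h1 h2 h3
        have h4 : Tendsto (fun n => f n ω) atTop (𝓝 (ENNReal.ofReal (rv Y ω))) := by
          rw [h2]
          exact tendsto_atTop_iSup fun _ _ h => hmono h ω
        have h5 := (ENNReal.tendsto_toReal ENNReal.ofReal_ne_top).comp h4
        rw [ENNReal.toReal_ofReal h3] at h5
        simp_rw [h1]
        simpa using (tendsto_const_nhds (x := rv Y ω)).sub h5
    have h1 : Tendsto (fun n => ENNReal.ofReal (g (W n))) atTop (𝓝 (ENNReal.ofReal (g Y))) := by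
      have : ∀ n, g (W n) = g Y - g (D n) := fun n => by
        rw [eq_sub_iff_add_eq, ← map_add, hWD]
      simp_rw [this]
      simpa using ENNReal.tendsto_ofReal ((tendsto_const_nhds (x := g Y)).sub hD0)
    simp_rw [fun n => ih n (W n) (hW n)] at h1
    rw [lintegral_iSup hf hmono]
    exact tendsto_nhds_unique h1 (tendsto_atTop_iSup fun _ _ h => lintegral_mono (hmono h))

theorem exists_eq_beta_mul_expect (hρ : IsReturnRiskMeasure ρ) (hconv : IsConvex ρ)
    (hL : LebesgueProperty ρ) (X : LinfPos P) :
    ∃ Q : ACProb P, (ρ X : ℝ≥0∞) = beta ρ Q * expect Q X := by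
  obtain ⟨g, hgX, hpos, hle⟩ := exists_linearMap_le hρ hconv X
  obtain ⟨ν, _, hac, hν⟩ := exists_measure_eq_lintegral g hpos fun Z Y hZY hZ => by
    have h := hL Z 0 ‖(Y : Lp ℝ ∞ P)‖ (tendstoInMeasure_of_tendsto_ae
        (fun n => (measurable_rv (Z n)).aestronglyMeasurable) (by
          filter_upwards [hZ, Lp.coeFn_zero ℝ ∞ P] with ω h1 h2
          have : rv (0 : LinfPos P) ω = 0 := h2
          rwa [this]))
      (fun n => norm_le_of_rv_le (norm_nonneg _) (by
        filter_upwards [ae_rv_le_norm Y, le_iff_rv_le.1 (hZY n)] with ω h1 h2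
        exact h2.trans h1))
    rw [hρ.map_zero] at h
    exact squeeze_zero (fun n => hpos _) (fun n => hle _) (NNReal.tendsto_coe.2 h)
  obtain ⟨Q, hQ⟩ := exists_lintegral_le_beta_mul_expect (ρ := ρ) ν hac fun Y hY => by
    rw [← hν, ← ENNReal.ofReal_one]
    exact ENNReal.ofReal_le_ofReal ((hle Y).trans (by exact_mod_cast hY))
  refine ⟨Q, le_antisymm ?_ (beta_mul_expect_le hρ Q X)⟩
  have := hQ X
  rwa [← hν, hgX, ENNReal.ofReal_coe_nnreal] at this

end

section

/-! ### Random variables without atoms on a nonatomic space -/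

variable {Ω : Type*} [MeasurableSpace Ω] {P : Measure Ω}

lemma IsNonatomic.exists_half (hP : IsNonatomic P) [IsFiniteMeasure P] {A : Set Ω}
    (hA : MeasurableSet A) (h0 : 0 < P A) :
    ∃ B, MeasurableSet B ∧ B ⊆ A ∧ 0 < P B ∧ P B ≤ P A / 2 := by
  obtain ⟨B, hB, hBA, hB0, hlt⟩ := hP A hA h0
  have hsum : P (A \ B) + P B = P A := by
    rw [add_comm, measure_add_sdiff hB.nullMeasurableSet, union_eq_self_of_subset_left hBA]
  rcases le_total (P B) (P (A \ B)) with h | h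
  · refine ⟨B, hB, hBA, hB0, ?_⟩
    rw [ENNReal.le_div_iff_mul_le (by simp) (by simp), mul_two, ← hsum]
    gcongr
  · refine ⟨A \ B, hA.diff hB, sdiff_subset, ?_, ?_⟩
    · rw [pos_iff_ne_zero]
      intro h'
      rw [h', zero_add] at hsum
      exact hlt.ne hsum
    · rw [ENNReal.le_div_iff_mul_le (by simp) (by simp), mul_two, ← hsum]
      gcongr

lemma IsNonatomic.exists_small (hP : IsNonatomic P) [IsProbabilityMeasure P] {A : Set Ω}
    (hA : MeasurableSet A) (h0 : 0 < P A) {ε : ℝ≥0∞} (hε : ε ≠ 0) :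
    ∃ B, MeasurableSet B ∧ B ⊆ A ∧ 0 < P B ∧ P B ≤ ε := by
  have h : ∀ n : ℕ, ∃ B, MeasurableSet B ∧ B ⊆ A ∧ 0 < P B ∧ P B ≤ (2⁻¹ : ℝ≥0∞) ^ n := by
    intro n
    induction n with
    | zero => exact ⟨A, hA, Subset.rfl, h0, by simpa using prob_le_one⟩
    | succ n ih =>
      obtain ⟨B, hB, hBA, hB0, hle⟩ := ih
      obtain ⟨C, hC, hCB, hC0, hle'⟩ := hP.exists_half hB hB0
      refine ⟨C, hC, hCB.trans hBA, hC0, hle'.trans ?_⟩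
      rw [pow_succ, ENNReal.div_eq_inv_mul, mul_comm]
      gcongr
  obtain ⟨n, hn⟩ := ENNReal.exists_inv_two_pow_lt hε
  obtain ⟨B, h1, h2, h3, h4⟩ := h n
  exact ⟨B, h1, h2, h3, h4.trans hn.le⟩

/-- Exhaustion: a countable union of small sets of maximal measure has null complement. -/
lemma IsNonatomic.exists_cover (hP : IsNonatomic P) [IsProbabilityMeasure P] {ε : ℝ≥0∞}
    (hε : ε ≠ 0) :
    ∃ A : ℕ → Set Ω, (∀ k, MeasurableSet (A k)) ∧ (∀ k, P (A k) ≤ ε) ∧ P (⋃ k, A k)ᶜ = 0 := by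
  let S : Set (ℕ → Set Ω) := {A | (∀ k, MeasurableSet (A k)) ∧ ∀ k, P (A k) ≤ ε}
  let m : (ℕ → Set Ω) → ℝ≥0∞ := fun A => P (⋃ k, A k)
  have hne : (m '' S).Nonempty := ⟨_, fun _ => ∅, ⟨fun _ => MeasurableSet.empty, by simp⟩, rfl⟩
  obtain ⟨u, -, hu, huS⟩ := exists_seq_tendsto_sSup hne (OrderTop.bddAbove _)
  choose A hAS hAu using huS
  let B : ℕ → Set Ω := fun j => A j.unpair.1 j.unpair.2
  have hBS : B ∈ S := ⟨fun j => (hAS _).1 _, fun j => (hAS _).2 _⟩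
  have hAB : ∀ n, (⋃ k, A n k) ⊆ ⋃ j, B j := fun n => iUnion_subset fun k => by
    refine (subset_iUnion B (Nat.pair n k)).trans' ?_
    simp [B]
  have hBmax : sSup (m '' S) ≤ P (⋃ j, B j) :=
    le_of_tendsto' hu fun n => by rw [← hAu n]; exact measure_mono (hAB n)
  refine ⟨B, hBS.1, hBS.2, ?_⟩
  by_contra hpos
  have hBm : MeasurableSet (⋃ j, B j) := MeasurableSet.iUnion hBS.1
  obtain ⟨C, hC, hCB, hC0, hCε⟩ := hP.exists_small hBm.compl (pos_iff_ne_zero.2 hpos) hε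
  let D : ℕ → Set Ω := fun n => Nat.casesOn n C B
  have hDS : D ∈ S := ⟨fun n => by cases n; exacts [hC, hBS.1 _],
    fun n => by cases n; exacts [hCε, hBS.2 _]⟩
  have hD : (⋃ n, B n) ∪ C ⊆ ⋃ n, D n :=
    union_subset (iUnion_subset fun n => subset_iUnion D (n + 1)) (subset_iUnion D 0)
  have h1 : P (⋃ n, B n) + P C ≤ P (⋃ n, B n) := by
    rw [← measure_union (disjoint_compl_right.mono_right hCB) hC]
    exact (measure_mono hD).trans ((le_sSup (mem_image_of_mem m hDS)).trans hBmax)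
  exact absurd h1 (not_le.2 (ENNReal.lt_add_right (measure_ne_top _ _) hC0.ne'))

/-- A nonatomic probability space carries a `[0, 1]`-valued random variable whose law has no
atoms. -/
lemma IsNonatomic.exists_measurable_fiber_null (hP : IsNonatomic P) [IsProbabilityMeasure P] :
    ∃ V : Ω → ℝ, Measurable V ∧ (∀ ω, V ω ∈ Icc (0 : ℝ) 1) ∧ ∀ v, P (V ⁻¹' {v}) = 0 := by
  classical
  choose A hAm hAε hA0 using fun n : ℕ =>
    hP.exists_cover (ε := (2⁻¹ : ℝ≥0∞) ^ n) (pow_ne_zero _ (by simp))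
  -- up to a null set, a fibre of `T` lies in one small set of each cover
  let T : Ω → ℕ × ℕ → Bool := fun ω i => decide (ω ∈ A i.1 i.2)
  have hT : Measurable T := measurable_pi_lambda _ fun i => measurable_to_bool (by
    have : (fun ω => T ω i) ⁻¹' {true} = A i.1 i.2 := by ext; simp [T]
    rw [this]; exact hAm _ _)
  have hfib : ∀ x, P (T ⁻¹' {x}) = 0 := by
    intro x
    have hle : ∀ n : ℕ, P (T ⁻¹' {x}) ≤ (2⁻¹ : ℝ≥0∞) ^ n := by
      intro n
      by_cases hx : ∃ k, x (n, k) = true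
      · obtain ⟨k, hk⟩ := hx
        refine (measure_mono ?_).trans (hAε n k)
        rintro ω rfl
        simpa [T] using hk
      · refine le_trans (measure_mono ?_) ((hA0 n).le.trans zero_le)
        rintro ω rfl
        simpa [T] using hx
    have hlim : Tendsto (fun n : ℕ => (2⁻¹ : ℝ≥0∞) ^ n) atTop (𝓝 0) :=
      ENNReal.tendsto_pow_atTop_nhds_zero_of_lt_one (by
        rw [ENNReal.inv_lt_one]; exact ENNReal.one_lt_two)
    exact le_antisymm (ge_of_tendsto' hlim hle) zero_le
  have hE := measurableEmbedding_sigmoid_comp_embeddingReal (ℕ × ℕ → Bool)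
  let E : (ℕ × ℕ → Bool) → ℝ := fun x =>
    ((unitInterval.sigmoid ∘ embeddingReal (ℕ × ℕ → Bool)) x : ℝ)
  have hEinj : Function.Injective E := Subtype.val_injective.comp hE.injective
  refine ⟨E ∘ T, (measurable_subtype_coe.comp hE.measurable).comp hT,
    fun ω => Subtype.prop _, fun v => ?_⟩
  by_cases hv : ∃ x, E x = v
  · obtain ⟨x, rfl⟩ := hv
    rw [preimage_comp, ← image_singleton, hEinj.preimage_image]
    exact hfib x
  · convert measure_empty (μ := P)
    exact eq_empty_of_forall_notMem fun ω hω => hv ⟨T ω, hω⟩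

end

section

/-! ### Quantile functions -/

variable {Ω : Type*} [MeasurableSpace Ω] {P : Measure Ω} [IsProbabilityMeasure P]
  {f : Ω → ℝ} {q : ℝ → ℝ}

lemma IsQuantileFunction.le_of_apply_le (hq : IsQuantileFunction P f q) {t x : ℝ}
    (ht : t ∈ Ioo (0 : ℝ) 1) (h : q t ≤ x) : t ≤ P.real {ω | f ω ≤ x} :=
  (hq t ht).2.trans (measureReal_mono fun _ hω => le_trans hω h)

lemma IsQuantileFunction.apply_le_of_lt (hq : IsQuantileFunction P f q) {t x : ℝ}
    (ht : t ∈ Ioo (0 : ℝ) 1) (h : t < P.real {ω | f ω ≤ x}) : q t ≤ x := by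
  by_contra! hx
  exact absurd h (not_lt.2 ((measureReal_mono fun _ hω => lt_of_le_of_lt hω hx).trans (hq t ht).1))

lemma IsQuantileFunction.monotoneOn (hq : IsQuantileFunction P f q) :
    MonotoneOn q (Ioo (0 : ℝ) 1) := by
  intro s hs t ht hst
  rcases hst.eq_or_lt with rfl | hlt
  · exact le_rfl
  · exact hq.apply_le_of_lt hs (hlt.trans_le (hq t ht).2)

lemma IsQuantileFunction.aemeasurable (hq : IsQuantileFunction P f q) :
    AEMeasurable q (volume.restrict (Ioo (0 : ℝ) 1)) :=
  aemeasurable_restrict_of_monotoneOn measurableSet_Ioo hq.monotoneOn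

/-- A quantile function of `f`, evaluated at a uniform level, has the law of `f`. -/
lemma IsQuantileFunction.map_eq (hq : IsQuantileFunction P f q) (hf : Measurable f) :
    (volume.restrict (Ioo (0 : ℝ) 1)).map q = P.map f := by
  have : IsProbabilityMeasure (P.map f) := Measure.isProbabilityMeasure_map hf.aemeasurable
  refine Measure.ext_of_Iic _ _ fun x => ?_
  rw [Measure.map_apply_of_aemeasurable hq.aemeasurable measurableSet_Iic,
    Measure.map_apply hf measurableSet_Iic, Measure.restrict_apply' measurableSet_Ioo]
  have hF : P (f ⁻¹' Iic x) = ENNReal.ofReal (P.real {ω | f ω ≤ x}) := by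
    rw [ofReal_measureReal]; rfl
  have hF1 : P.real {ω | f ω ≤ x} ≤ 1 := measureReal_le_one
  rw [hF]
  refine le_antisymm ?_ ?_
  · refine (measure_mono (t := Ioc 0 (P.real {ω | f ω ≤ x})) ?_).trans
      (by rw [Real.volume_Ioc, sub_zero])
    exact fun t ht => ⟨ht.2.1, hq.le_of_apply_le ht.2 ht.1⟩
  · refine le_trans (by rw [Real.volume_Ioo, sub_zero])
      (measure_mono (s := Ioo 0 (P.real {ω | f ω ≤ x})) ?_)
    intro t ht
    have ht' : t ∈ Ioo (0 : ℝ) 1 := ⟨ht.1, ht.2.trans_le hF1⟩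
    exact ⟨hq.apply_le_of_lt ht' ht.2, ht'⟩

omit [IsProbabilityMeasure P] in
lemma IsQuantileFunction.nonneg (hq : IsQuantileFunction P f q) (hf0 : 0 ≤ᵐ[P] f) {t : ℝ}
    (ht : t ∈ Ioo (0 : ℝ) 1) : 0 ≤ q t := by
  by_contra! h
  have h1 := (hq t ht).2
  have h2 : P {ω | f ω ≤ q t} = 0 := measure_eq_zero_iff_ae_notMem.2 (by
    filter_upwards [hf0] with ω h3 (h4 : f ω ≤ q t)
    exact absurd (h3.trans h4) (not_le.2 h))
  rw [measureReal_def, h2] at h1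
  exact absurd ht.1 (not_lt.2 h1)

/-- Distributional transform: on a nonatomic space, `f` is its quantile function evaluated at
a uniform random variable. The latter is the probability of lying below the given point in the
lexicographic order of `(f, V)`, where `V` has no atoms and breaks ties. -/
lemma IsQuantileFunction.exists_uniform (hP : IsNonatomic P) (hq : IsQuantileFunction P f q)
    (hf : Measurable f) :
    ∃ U : Ω → ℝ, Measurable U ∧ P.map U = volume.restrict (Ioo (0 : ℝ) 1) ∧
      f =ᵐ[P] q ∘ U := by
  obtain ⟨V, hV, hV01, hV0⟩ := hP.exists_measurable_fiber_null
  let D : ℝ × ℝ → Set Ω := fun p => {ω | f ω < p.1 ∨ (f ω = p.1 ∧ V ω < p.2)}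
  have hDm : ∀ p, MeasurableSet (D p) := fun p =>
    (measurableSet_lt hf measurable_const).union
      ((measurableSet_eq_fun hf measurable_const).inter (measurableSet_lt hV measurable_const))
  let U : Ω → ℝ := fun ω => P.real (D (f ω, V ω))
  have hUm : Measurable U := by
    have hS : MeasurableSet {z : Ω × Ω | f z.2 < f z.1 ∨ (f z.2 = f z.1 ∧ V z.2 < V z.1)} := by
      have h1 := hf.comp (measurable_fst : Measurable (Prod.fst : Ω × Ω → Ω))
      have h2 := hf.comp (measurable_snd : Measurable (Prod.snd : Ω × Ω → Ω))
      have h3 := hV.comp (measurable_fst : Measurable (Prod.fst : Ω × Ω → Ω))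
      have h4 := hV.comp (measurable_snd : Measurable (Prod.snd : Ω × Ω → Ω))
      exact (measurableSet_lt h2 h1).union ((measurableSet_eq_fun h2 h1).inter
        (measurableSet_lt h4 h3))
    exact (measurable_measure_prodMk_left (ν := P) hS).ennreal_toReal
  have hU1 : ∀ ω, P.real {ω' | f ω' < f ω} ≤ U ω := fun ω =>
    measureReal_mono fun _ h => Or.inl h
  have hU2 : ∀ ω, U ω ≤ P.real {ω' | f ω' ≤ f ω} := fun ω =>
    measureReal_mono fun _ h => h.elim le_of_lt fun h => h.1.le
  have hUid : IsQuantileFunction P U id := by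
    intro t ht
    set x := q t with hx
    have hcont : Continuous fun v => P.real (D (x, v)) := by
      refine continuous_iff_continuousAt.2 fun v => ?_
      refine (ENNReal.tendsto_toReal (measure_ne_top P _)).comp ?_
      refine tendsto_measure_of_ae_tendsto_indicator (𝓝 v) (hDm _) (fun w => hDm _)
        MeasurableSet.univ (measure_ne_top P univ) (Eventually.of_forall fun w => subset_univ _) ?_
      filter_upwards [measure_eq_zero_iff_ae_notMem.1 (hV0 v)] with ω hω
      have hne : V ω ≠ v := hω
      rcases lt_or_gt_of_ne hne with h | h
      · filter_upwards [lt_mem_nhds h] with w hw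
        simp [D, h, hw]
      · filter_upwards [gt_mem_nhds h] with w hw
        simp [D, h.not_gt, hw.not_gt]
    -- the intermediate value theorem places the level `t` inside the possible atom of `f` at `q t`
    obtain ⟨v, -, hv⟩ : t ∈ (fun v => P.real (D (x, v))) '' Icc 0 2 := by
      refine intermediate_value_Icc zero_le_two hcont.continuousOn ⟨?_, ?_⟩
      · refine le_trans (measureReal_mono ?_) (hq t ht).1
        rintro ω (h | h)
        · exact h
        · exact absurd h.2 (not_lt.2 (hV01 ω).1)
      · refine (hq t ht).2.trans (measureReal_mono ?_)
        intro ω (h : f ω ≤ x)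
        rcases h.lt_or_eq with h | h
        · exact Or.inl h
        · exact Or.inr ⟨h, (hV01 ω).2.trans_lt one_lt_two⟩
    replace hv : P.real (D (x, v)) = t := hv
    constructor
    · refine (measureReal_mono (s₂ := D (x, v)) ?_).trans hv.le
      intro ω (hω : U ω < t)
      by_contra hn
      refine absurd hω (not_lt.2 (hv ▸ measureReal_mono ?_))
      intro ω' h'
      simp only [D, mem_ofPred_eq] at hn h' ⊢
      grind
    · refine hv.ge.trans (measureReal_mono ?_)
      intro ω hω
      refine le_trans (measureReal_mono ?_) hv.le
      intro ω' h'
      simp only [D, mem_ofPred_eq] at hω h' ⊢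
      grind
  have hlaw : P.map U = volume.restrict (Ioo (0 : ℝ) 1) := by
    rw [← hUid.map_eq hUm, Measure.map_id]
  refine ⟨U, hUm, hlaw, ?_⟩
  have hU01 : ∀ᵐ ω ∂P, U ω ∈ Ioo (0 : ℝ) 1 :=
    ae_of_ae_map hUm.aemeasurable (by rw [hlaw]; exact ae_restrict_mem measurableSet_Ioo)
  have hUne : ∀ᵐ ω ∂P, ∀ r : ℚ, U ω ≠ P.real {ω | f ω ≤ r} :=
    ae_all_iff.2 fun r => ae_of_ae_map (p := fun u => u ≠ P.real {ω | f ω ≤ r}) hUm.aemeasurable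
      (by rw [hlaw]; exact ae_restrict_of_ae (Measure.ae_ne volume _))
  filter_upwards [hU01, hUne] with ω h01 hne
  have hiff : ∀ r : ℚ, f ω ≤ r ↔ q (U ω) ≤ r := fun r => by
    constructor
    · intro h
      refine hq.apply_le_of_lt h01 (lt_of_le_of_ne ((hU2 ω).trans ?_) (hne r))
      exact measureReal_mono fun _ h' => le_trans h' h
    · intro h
      by_contra! hlt
      refine absurd (lt_of_le_of_ne (hq.le_of_apply_le h01 h) (hne r)) (not_lt.2 ?_)
      exact (measureReal_mono fun _ h' => lt_of_le_of_lt h' hlt).trans (hU1 ω)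
  exact eq_of_forall_rat_lt_iff_lt fun r => by rw [← not_le, ← not_le, hiff r]; rfl

/-- Layer-cake formula for a product of two nonnegative functions. -/
lemma lintegral_mul_eq_lintegral_meas_lt {α : Type*} [MeasurableSpace α] (μ : Measure α)
    [IsFiniteMeasure μ] {f g : α → ℝ} (hf : AEMeasurable f μ) (hg : AEMeasurable g μ)
    (hf0 : 0 ≤ᵐ[μ] f) (hg0 : 0 ≤ᵐ[μ] g) :
    ∫⁻ a, ENNReal.ofReal (f a * g a) ∂μ
      = ∫⁻ t in Ioi (0 : ℝ), ∫⁻ s in Ioi (0 : ℝ), μ {a | s < f a ∧ t < g a} := by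
  have hac : μ.withDensity (fun a => ENNReal.ofReal (f a)) ≪ μ :=
    withDensity_absolutelyContinuous _ _
  have h1 : ∫⁻ a, ENNReal.ofReal (f a * g a) ∂μ
      = ∫⁻ a, ENNReal.ofReal (g a) ∂(μ.withDensity fun a => ENNReal.ofReal (f a)) := by
    rw [lintegral_withDensity_eq_lintegral_mul₀ hf.ennreal_ofReal hg.ennreal_ofReal]
    refine lintegral_congr_ae ?_
    filter_upwards [hf0] with a h
    rw [Pi.mul_apply, ENNReal.ofReal_mul h]
  rw [h1, lintegral_eq_lintegral_meas_lt _ (hac.ae_le hg0) (hg.mono_ac hac)]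
  refine lintegral_congr fun t => ?_
  rw [withDensity_apply', lintegral_eq_lintegral_meas_lt _ (ae_restrict_of_ae hf0) hf.restrict]
  refine lintegral_congr fun s => ?_
  rw [Measure.restrict_apply₀ (nullMeasurableSet_lt aemeasurable_const hf.restrict)]
  rfl

/-- Hardy–Littlewood inequality. The upper level sets of two monotone functions are nested, so
the rearranged side has the largest joint upper level sets possible for the given laws. -/
lemma lintegral_mul_le_quantileIntegral {g : Ω → ℝ} {r : ℝ → ℝ} (hf : Measurable f)
    (hg : Measurable g) (hf0 : 0 ≤ᵐ[P] f) (hg0 : 0 ≤ᵐ[P] g) (hq : IsQuantileFunction P f q)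
    (hr : IsQuantileFunction P g r) :
    ∫⁻ ω, ENNReal.ofReal (f ω * g ω) ∂P ≤ quantileIntegral q r := by
  rw [quantileIntegral,
    lintegral_mul_eq_lintegral_meas_lt P hf.aemeasurable hg.aemeasurable hf0 hg0,
    lintegral_mul_eq_lintegral_meas_lt _ hq.aemeasurable hr.aemeasurable
      (ae_restrict_of_forall_mem measurableSet_Ioo fun t ht => hq.nonneg hf0 ht)
      (ae_restrict_of_forall_mem measurableSet_Ioo fun t ht => hr.nonneg hg0 ht)]
  have hlevel : ∀ {h : Ω → ℝ} {p : ℝ → ℝ} (_ : Measurable h) (_ : IsQuantileFunction P h p) (s : ℝ),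
      P {ω | s < h ω} = volume.restrict (Ioo (0 : ℝ) 1) {t | s < p t} := by
    intro h p hh hp s
    have := congrArg (fun μ => μ (Ioi s)) (hp.map_eq hh)
    beta_reduce at this
    rw [Measure.map_apply_of_aemeasurable hp.aemeasurable measurableSet_Ioi,
      Measure.map_apply hh measurableSet_Ioi] at this
    exact this.symm
  refine lintegral_mono fun t => lintegral_mono fun s => ?_
  by_cases hnest : ∀ u ∈ Ioo (0 : ℝ) 1, s < q u → t < r u
  · calc P {ω | s < f ω ∧ t < g ω} ≤ P {ω | s < f ω} := measure_mono fun _ h => h.1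
      _ = volume.restrict (Ioo (0 : ℝ) 1) {u | s < q u} := hlevel hf hq s
      _ ≤ _ := measure_mono_ae (by
        filter_upwards [ae_restrict_mem measurableSet_Ioo] with u hu h
        exact ⟨h, hnest u hu h⟩)
  · push Not at hnest
    obtain ⟨u, hu, hsu, htu⟩ := hnest
    calc P {ω | s < f ω ∧ t < g ω} ≤ P {ω | t < g ω} := measure_mono fun _ h => h.2
      _ = volume.restrict (Ioo (0 : ℝ) 1) {u | t < r u} := hlevel hg hr t
      _ ≤ _ := measure_mono_ae (by
        filter_upwards [ae_restrict_mem measurableSet_Ioo] with w hw (h : t < r w)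
        refine ⟨?_, h⟩
        have huw : u ≤ w := by
          by_contra! hlt
          exact absurd (h.trans_le (hr.monotoneOn hw hu hlt.le)) (not_lt.2 htu)
        exact hsu.trans_le (hq.monotoneOn hu hw huw))

/-! ### The quantile representation -/

omit [IsProbabilityMeasure P] in
lemma measurable_density (Q : ACProb P) : Measurable (density Q) :=
  (Measure.measurable_rnDeriv _ _).ennreal_toReal

omit [IsProbabilityMeasure P] in
lemma density_nonneg (Q : ACProb P) : 0 ≤ᵐ[P] density Q :=
  ae_of_all _ fun _ => ENNReal.toReal_nonneg

lemma expect_eq_lintegral_mul_density (Q : ACProb P) (X : LinfPos P) :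
    expect Q X = ∫⁻ ω, ENNReal.ofReal (rv X ω * density Q ω) ∂P := by
  have := Q.2.1
  rw [expect, ← lintegral_rnDeriv_mul Q.2.2 (measurable_rv X).ennreal_ofReal.aemeasurable]
  refine lintegral_congr_ae ?_
  filter_upwards [rv_nonneg X, Measure.rnDeriv_ne_top Q.1 P] with ω h1 h2
  rw [ENNReal.ofReal_mul h1, density, ENNReal.ofReal_toReal h2, mul_comm]

/-- On a nonatomic space, the Hardy–Littlewood bound is attained by a rearrangement of `X`. -/
lemma exists_rearrangement (hP : IsNonatomic P) (Q : ACProb P) (X : LinfPos P) {qX qφ : ℝ → ℝ}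
    (hX : IsQuantileFunction P (rv X) qX) (hφ : IsQuantileFunction P (density Q) qφ) :
    ∃ Y : LinfPos P, P.map (rv Y) = P.map (rv X) ∧ expect Q Y = quantileIntegral qX qφ := by
  obtain ⟨U, hU, hlaw, hφU⟩ := hφ.exists_uniform hP (measurable_density Q)
  have hqU : AEMeasurable qX (P.map U) := by rw [hlaw]; exact hX.aemeasurable
  have hXU : AEMeasurable (qX ∘ U) P := hqU.comp_measurable hU
  have hmap : P.map (qX ∘ U) = P.map (rv X) := by
    rw [← AEMeasurable.map_map_of_aemeasurable hqU hU.aemeasurable, hlaw,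
      hX.map_eq (measurable_rv X)]
  have hid : ProbabilityTheory.IdentDistrib (rv X) (qX ∘ U) P P :=
    ⟨(measurable_rv X).aemeasurable, hXU, hmap.symm⟩
  have hL : MemLp (qX ∘ U) ∞ P := hid.memLp_snd (memLp_rv X)
  have h0 : 0 ≤ᵐ[P] qX ∘ U := by
    have h01 : ∀ᵐ ω ∂P, U ω ∈ Ioo (0 : ℝ) 1 :=
      ae_of_ae_map hU.aemeasurable (by rw [hlaw]; exact ae_restrict_mem measurableSet_Ioo)
    filter_upwards [h01] with ω h
    exact hX.nonneg (rv_nonneg X) h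
  refine ⟨ofFun _ hL h0, by rw [Measure.map_congr (rv_ofFun hL h0), hmap], ?_⟩
  rw [expect_eq_lintegral_mul_density, quantileIntegral, ← hlaw, lintegral_map' ?_ hU.aemeasurable]
  · refine lintegral_congr_ae ?_
    filter_upwards [rv_ofFun hL h0, hφU] with ω h1 h2
    rw [h1, h2]; rfl
  · rw [hlaw]
    exact (hX.aemeasurable.mul hφ.aemeasurable).ennreal_ofReal

lemma expect_le_quantileIntegral (Q : ACProb P) (X : LinfPos P) {qX qφ : ℝ → ℝ}
    (hX : IsQuantileFunction P (rv X) qX) (hφ : IsQuantileFunction P (density Q) qφ) :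
    expect Q X ≤ quantileIntegral qX qφ := by
  rw [expect_eq_lintegral_mul_density]
  exact lintegral_mul_le_quantileIntegral (measurable_rv X) (measurable_density Q) (rv_nonneg X)
    (density_nonneg Q) hX hφ

theorem beta_eq_inv_iSup_quantileIntegral {ρ : LinfPos P → ℝ≥0} (hP : IsNonatomic P)
    (hlaw : LawInvariant ρ) {qX : LinfPos P → ℝ → ℝ} {qφ : ℝ → ℝ} (Q : ACProb P)
    (hX : ∀ X, IsQuantileFunction P (rv X) (qX X)) (hφ : IsQuantileFunction P (density Q) qφ) :
    beta ρ Q = (⨆ X ∈ acceptanceSet ρ, quantileIntegral (qX X) qφ)⁻¹ := by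
  rw [beta]
  congr 1
  refine le_antisymm (iSup₂_mono fun X _ => expect_le_quantileIntegral Q X (hX X) hφ)
    (iSup₂_le fun X hXB => ?_)
  obtain ⟨Y, hYX, hY⟩ := exists_rearrangement hP Q X (hX X) hφ
  rw [← hY]
  exact le_iSup₂_of_le Y ((hlaw Y X hYX).trans_le hXB) le_rfl

theorem eq_iSup_beta_mul_quantileIntegral {ρ : LinfPos P → ℝ≥0} (hP : IsNonatomic P)
    (hρ : IsReturnRiskMeasure ρ) (hconv : IsConvex ρ) (hFatou : FatouProperty ρ)
    (hlaw : LawInvariant ρ) {qφ : ACProb P → ℝ → ℝ} (X : LinfPos P) {qX : ℝ → ℝ}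
    (hX : IsQuantileFunction P (rv X) qX)
    (hφ : ∀ Q, IsQuantileFunction P (density Q) (qφ Q)) :
    (ρ X : ℝ≥0∞) = ⨆ Q : ACProb P, beta ρ Q * quantileIntegral qX (qφ Q) := by
  refine le_antisymm ?_ (iSup_le fun Q => ?_)
  · rw [eq_iSup_beta_mul_expect hρ hconv hFatou X]
    exact iSup_mono fun Q => by gcongr; exact expect_le_quantileIntegral Q X hX (hφ Q)
  · obtain ⟨Y, hYX, hY⟩ := exists_rearrangement hP Q X hX (hφ Q)
    rw [← hY, ← hlaw Y X hYX]
    exact beta_mul_expect_le hρ Q Y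

end

end ReturnRisk

theorem mainTheorem6 {Ω : Type*} [MeasurableSpace Ω] (P : Measure Ω) [IsProbabilityMeasure P]
    (hP : ReturnRisk.IsNonatomic P)
    (ρ : ReturnRisk.LinfPos P → ℝ≥0)
    (hρ : ReturnRisk.IsReturnRiskMeasure ρ)
    (hconv : ReturnRisk.IsConvex ρ)
    (hFatou : ReturnRisk.FatouProperty ρ) :
    -- `β` takes values in `[0, 1]`, and the dual representation holds
    (∀ Q : ReturnRisk.ACProb P, ReturnRisk.beta ρ Q ≤ 1) ∧
    (∀ X : ReturnRisk.LinfPos P,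
      (ρ X : ℝ≥0∞) = ⨆ Q : ReturnRisk.ACProb P, ReturnRisk.beta ρ Q * ReturnRisk.expect Q X) ∧
    -- under the Lebesgue property the supremum is attained
    (ReturnRisk.LebesgueProperty ρ → ∀ X : ReturnRisk.LinfPos P,
      ∃ Q : ReturnRisk.ACProb P,
        (ρ X : ℝ≥0∞) = ReturnRisk.beta ρ Q * ReturnRisk.expect Q X) ∧
    -- quantile form under law-invariance, for all versions of the quantile functions
    (ReturnRisk.LawInvariant ρ →
      ∀ (qX : ReturnRisk.LinfPos P → ℝ → ℝ) (qφ : ReturnRisk.ACProb P → ℝ → ℝ),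
        (∀ X, ReturnRisk.IsQuantileFunction P (ReturnRisk.rv X) (qX X)) →
        (∀ Q, ReturnRisk.IsQuantileFunction P (ReturnRisk.density Q) (qφ Q)) →
        (∀ Q : ReturnRisk.ACProb P,
          ReturnRisk.beta ρ Q =
            (⨆ X ∈ ReturnRisk.acceptanceSet ρ,
              ReturnRisk.quantileIntegral (qX X) (qφ Q))⁻¹) ∧
        (∀ X : ReturnRisk.LinfPos P,
          (ρ X : ℝ≥0∞) = ⨆ Q : ReturnRisk.ACProb P,
            ReturnRisk.beta ρ Q * ReturnRisk.quantileIntegral (qX X) (qφ Q))) := by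
  refine ⟨ReturnRisk.beta_le_one hρ, ReturnRisk.eq_iSup_beta_mul_expect hρ hconv hFatou,
    ReturnRisk.exists_eq_beta_mul_expect hρ hconv,
    fun hlaw qX qφ hX hφ => ⟨fun Q => ?_, fun X => ?_⟩⟩
  · exact ReturnRisk.beta_eq_inv_iSup_quantileIntegral hP hlaw Q hX (hφ Q)
  · exact ReturnRisk.eq_iSup_beta_mul_quantileIntegral hP hρ hconv hFatou hlaw X (hX X) hφ
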